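/- Let $\mathbb{MC}(0)=\mathbb{R}$ and, for $n\ge 1$, let $\mathbb{MC}(n)=\{\eta_1+\eta_2 i_n : \eta_1,\eta_2\in\mathbb{MC}(n-1)\}$, where $i_n$ is a new unit (two such elements are equal if and only if their components $\eta_1,\eta_2$ agree), with componentwise addition and real scalar multiplication, and with the multiplication $(\eta_1+\eta_2 i_n)(\zeta_1+\zeta_2 i_n)=(\eta_1\zeta_1-\eta_2\zeta_2)+(\eta_1\zeta_2+\eta_2\zeta_1)i_n$, so that $i_n^2=-1$. This is a commutative real algebra, the algebra of multicomplex numbers of order $n$. An involution of $\mathbb{MC}(n)$ is a map $f:\mathbb{MC}(n)\to\mathbb{MC}(n)$ that is $\mathbb{R}$-linear, satisfies $f(\eta\zeta)=f(\eta)f(\zeta)$ for all $\eta,\zeta$, and satisfies $f(f(\eta))=\eta$ for all $\eta$ (the identity map is included). Then for every integer $n\ge 1$ the number $F(n)$ of involutions of $\mathbb{MC}(n)$ is finite, and the following hold. (i) For every $n\ge 1$, $$F(n)=(2^{n-1})!\sum_{k=0}^{\lfloor 2^{n-2}\rfloor}\frac{2^{2^{n-1}-2k}}{k!\,(2^{n-1}-2k)!}.$$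 (ii) If $g(1)=2$, $g(2)=6$ and $g(m)=2g(m-1)+(2m-2)g(m-2)$ for all integers $m\ge 3$, then $F(n)=g(2^{n-1})$ for every $n\ge 1$. (iii) As $n\to\infty$, $$F(n)\sim\Bigl(\frac{2^n}{e}\Bigr)^{2^{n-2}}\frac{e^{2^{n/2}}}{\sqrt{2e}},$$ that is, the ratio of the two sides tends to $1$. -/

import Mathlib

open scoped Nat
open Asymptotics Filter

/-- The multicomplex numbers of order `n`, as a commutative real algebra: order `0` is `ℝ`, and
order `n + 1` consists of the elements `η₁ + η₂ i` with `η₁, η₂` multicomplex of order `n`, where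
`i` is a new unit commuting with everything and `i ^ 2 = -1`. Operations are
`(η₁ + η₂ i) + (ζ₁ + ζ₂ i) = (η₁ + ζ₁) + (η₂ + ζ₂) i`,
`(η₁ + η₂ i) (ζ₁ + ζ₂ i) = (η₁ ζ₁ - η₂ ζ₂) + (η₁ ζ₂ + η₂ ζ₁) i`, and
`r • (η₁ + η₂ i) = r • η₁ + (r • η₂) i` for real `r`. -/
noncomputable def multicomplexAlg : ℕ → CommAlgCat.{0} ℝ
  | 0 => CommAlgCat.of ℝ ℝ
  | n + 1 => CommAlgCat.of ℝ (QuadraticAlgebra (multicomplexAlg n) (-1) 0)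

/-- The ring `𝕄ℂ(n)` of multicomplex numbers of order `n`. -/
abbrev MC (n : ℕ) : Type := multicomplexAlg n

/-- An involution of `𝕄ℂ(n)`: a real-linear, multiplicative self-map which is its own inverse. -/
structure IsMCInvolution {n : ℕ} (f : MC n → MC n) : Prop where
  involutive : ∀ η : MC n, f (f η) = η
  map_add : ∀ η ζ : MC n, f (η + ζ) = f η + f ζ
  map_smul : ∀ (r : ℝ) (η : MC n), f (r • η) = r • f η
  map_mul : ∀ η ζ : MC n, f (η * ζ) = f η * f ζ

/-- The number `F(n)` of involutions of `𝕄ℂ(n)`. -/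
noncomputable def numInvolutions (n : ℕ) : ℕ :=
  Nat.card {f : MC n → MC n // IsMCInvolution f}

/-!
The algebra `MC (n + 1)` is a product of `2 ^ n` copies of `ℂ`: if `A ≃ ℂ ^ ι`, then `A` already
contains a square root `I` of `-1`, so adjoining another one splits, through
`x + y i ↦ (x + I y, x - I y)` (`exists_multicomplexEquiv`). An involution preserves `1`, and the
only real algebra homomorphisms `ℂ ^ ι → ℂ` are the coordinates and their conjugates. Hence an
involution permutes the coordinates by an involution `σ` of the index set and conjugates some of
them, the set of conjugated indices being a union of orbits of `σ` (`signedInvolutionEquiv`).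

Put `m = 2 ^ (n - 1)`. There are `m! / ((m - 2k)! 2^k k!)` involutions `σ` with `k` transpositions,
and each has `2 ^ (m - k)` admissible sets of conjugated indices; summing over `k` gives the closed
formula (`card_signedInvolution`). It is `m!` times the coefficient of `x ^ m` in
`exp (2 x + x ^ 2)`, which gives the recurrence (`signedInvolutionCount_add_two`).

For the asymptotics, integration by parts shows that the moments of the weight `exp (x - x ^ 2 / 4)`
satisfy the same recurrence, so the count is
`(e √(4π))⁻¹ ∫ x ^ m exp (x - x ^ 2 / 4)` (`integral_pow_mul_exp_sub_sq`). Laplace's method at the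
peak `s = √(2 m)` of `x ^ m exp (-x ^ 2 / 4)` finishes the proof: with `x = s + u`, the integrand
divided by `s ^ m exp (s - m / 2)` tends to `exp (u - u ^ 2 / 2)` and, by `log (1 + v) ≤ v`, is
dominated by `2 exp (u - u ^ 2 / 4)` (`tendsto_integral_laplaceIntegrand`). The negative half-line
is folded onto the positive one, as `m` is even for `n ≥ 2`.
-/

/-! ### Involutions of real algebras -/

/-- An involution of a real algebra: a real-linear, multiplicative self-map which is its own
inverse. -/
structure IsAlgInvolution {A : Type*} [Ring A] [Algebra ℝ A] (f : A → A) : Prop where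
  involutive : ∀ x, f (f x) = x
  map_add : ∀ x y, f (x + y) = f x + f y
  map_smul : ∀ (r : ℝ) x, f (r • x) = r • f x
  map_mul : ∀ x y, f (x * y) = f x * f y

namespace IsAlgInvolution

variable {A B : Type*} [Ring A] [Algebra ℝ A] [Ring B] [Algebra ℝ B]

theorem map_one {f : A → A} (hf : IsAlgInvolution f) : f 1 = 1 := by
  have h := hf.map_mul 1 (f 1)
  rw [hf.involutive, one_mul, mul_one, hf.involutive] at h
  exact h.symm

theorem map_zero {f : A → A} (hf : IsAlgInvolution f) : f 0 = 0 := by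
  simpa using hf.map_smul 0 0

/-- An involution as an algebra homomorphism; preservation of `1` comes from surjectivity. -/
def toAlgHom {f : A → A} (hf : IsAlgInvolution f) : A →ₐ[ℝ] A where
  toFun := f
  map_one' := hf.map_one
  map_mul' := hf.map_mul
  map_zero' := hf.map_zero
  map_add' := hf.map_add
  commutes' r := by rw [Algebra.algebraMap_eq_smul_one, hf.map_smul, hf.map_one]

theorem conj {f : A → A} (hf : IsAlgInvolution f) (e : A ≃ₐ[ℝ] B) :
    IsAlgInvolution fun x => e (f (e.symm x)) where
  involutive x := by simp [hf.involutive]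
  map_add x y := by simp [hf.map_add]
  map_smul r x := by simp [hf.map_smul]
  map_mul x y := by simp [hf.map_mul]

/-- Isomorphic algebras have the same involutions. -/
def congr (e : A ≃ₐ[ℝ] B) :
    {f : A → A // IsAlgInvolution f} ≃ {f : B → B // IsAlgInvolution f} where
  toFun f := ⟨_, f.2.conj e⟩
  invFun f := ⟨_, f.2.conj e.symm⟩
  left_inv f := by ext; simp
  right_inv f := by ext; simp

end IsAlgInvolution

theorem isMCInvolution_iff {n : ℕ} (f : MC n → MC n) :
    IsMCInvolution f ↔ IsAlgInvolution f :=
  ⟨fun h => ⟨h.1, h.2, h.3, h.4⟩, fun h => ⟨h.1, h.2, h.3, h.4⟩⟩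

/-! ### Multicomplex numbers as a power of the complex numbers -/

section Splitting

variable {A : Type*} [CommRing A] [Algebra ℝ A]

/-- `QuadraticAlgebra ℝ (-1) 0` is the field of complex numbers. -/
noncomputable def quadraticAlgebraRealEquiv : QuadraticAlgebra ℝ (-1) 0 ≃ₐ[ℝ] ℂ where
  toFun x := ⟨x.re, x.im⟩
  invFun z := ⟨z.re, z.im⟩
  left_inv _ := rfl
  right_inv _ := rfl
  map_mul' x y := by
    apply Complex.ext
    · simp [sub_eq_add_neg]
    · simp
  map_add' x y := by apply Complex.ext <;> simp
  commutes' r := by apply Complex.ext <;> rfl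

/-- If `A ≃ ι → ℂ`, then `A` contains a square root `I` of `-1`, and adjoining a further square
root `i` of `-1` splits: `x + y i ↦ (x + I y, x - I y)`. -/
noncomputable def quadraticAlgebraPiEquiv {ι : Type*} (e : A ≃ₐ[ℝ] (ι → ℂ)) :
    QuadraticAlgebra A (-1) 0 ≃ₐ[ℝ] (ι ⊕ ι → ℂ) where
  toFun x := Sum.elim (fun j => e x.re j + Complex.I * e x.im j)
    (fun j => e x.re j - Complex.I * e x.im j)
  invFun y := ⟨e.symm fun j => (y (.inl j) + y (.inr j)) / 2,
    e.symm fun j => -Complex.I * (y (.inl j) - y (.inr j)) / 2⟩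
  left_inv x := by
    ext
    · simp only [Sum.elim_inl, Sum.elim_inr]
      rw [AlgEquiv.symm_apply_eq]
      ext j; ring
    · simp only [Sum.elim_inl, Sum.elim_inr]
      rw [AlgEquiv.symm_apply_eq]
      ext j; ring_nf; simp
  right_inv y := by
    ext j
    rcases j with j | j
    · simp only [Sum.elim_inl, AlgEquiv.apply_symm_apply]
      ring_nf; simp; ring
    · simp only [Sum.elim_inr, AlgEquiv.apply_symm_apply]
      ring_nf; simp; ring
  map_mul' x y := by
    ext j
    rcases j with j | j <;> simp <;> ring_nf <;> simp <;> ring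
  map_add' x y := by
    ext j
    rcases j with j | j <;> simp <;> ring
  commutes' r := by
    ext j
    have hre : (algebraMap ℝ (QuadraticAlgebra A (-1) 0) r).re = algebraMap ℝ A r := rfl
    have him : (algebraMap ℝ (QuadraticAlgebra A (-1) 0) r).im = 0 := rfl
    rcases j with j | j <;> simp [hre, him]

end Splitting

/-- The algebra of multicomplex numbers of order `n + 1` is a product of `2 ^ n` copies of `ℂ`. -/
theorem exists_multicomplexEquiv (n : ℕ) :
    ∃ (ι : Type) (_ : Fintype ι), Fintype.card ι = 2 ^ n ∧
      Nonempty (MC (n + 1) ≃ₐ[ℝ] (ι → ℂ)) := by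
  induction n with
  | zero =>
    exact ⟨Unit, inferInstance, rfl,
      ⟨quadraticAlgebraRealEquiv.trans (AlgEquiv.funUnique ℝ Unit ℂ).symm⟩⟩
  | succ n ih =>
    obtain ⟨ι, _, hι, ⟨e⟩⟩ := ih
    exact ⟨ι ⊕ ι, inferInstance, by rw [Fintype.card_sum, hι]; ring,
      ⟨quadraticAlgebraPiEquiv e⟩⟩

/-! ### Involutions of a power of the complex numbers -/

/-- Complex conjugation if `b` is true, the identity otherwise. -/
noncomputable def conjIf (b : Bool) (z : ℂ) : ℂ := if b then star z else z

theorem conjIf_add (b : Bool) (z w : ℂ) : conjIf b (z + w) = conjIf b z + conjIf b w := by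
  cases b <;> simp [conjIf]

theorem conjIf_mul (b : Bool) (z w : ℂ) : conjIf b (z * w) = conjIf b z * conjIf b w := by
  cases b <;> simp [conjIf]

theorem conjIf_smul (b : Bool) (r : ℝ) (z : ℂ) : conjIf b (r • z) = r • conjIf b z := by
  cases b <;> simp [conjIf]

theorem conjIf_conjIf_self (b : Bool) (z : ℂ) : conjIf b (conjIf b z) = z := by
  cases b <;> simp [conjIf]

@[simp] theorem conjIf_one (b : Bool) : conjIf b 1 = 1 := by cases b <;> simp [conjIf]

@[simp] theorem conjIf_zero (b : Bool) : conjIf b 0 = 0 := by cases b <;> simp [conjIf]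

theorem conjIf_I_injective : Function.Injective fun b => conjIf b Complex.I := by
  have h : Complex.I ≠ -Complex.I := by
    intro h
    have := congrArg Complex.im h
    norm_num at this
  intro b c hbc
  cases b <;> cases c <;> simp_all [conjIf, eq_comm]

/-- A pair of maps `σ : ι → ι`, `ε : ι → Bool` such that `σ` is an involution and `ε` is constant on
its orbits: the involutions of the signed permutation group of `ι`. -/
abbrev SignedInvolution (ι : Type*) : Type _ :=
  {p : (ι → ι) × (ι → Bool) // Function.Involutive p.1 ∧ ∀ i, p.2 (p.1 i) = p.2 i}

section Pi

variable {ι : Type*}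

theorem SignedInvolution.isAlgInvolution (p : SignedInvolution ι) :
    IsAlgInvolution fun (x : ι → ℂ) i => conjIf (p.1.2 i) (x (p.1.1 i)) where
  involutive x := by ext i; simp [p.2.2, p.2.1 i, conjIf_conjIf_self]
  map_add x y := by ext i; simp [conjIf_add]
  map_smul r x := by ext i; exact conjIf_smul _ _ _
  map_mul x y := by ext i; simp [conjIf_mul]

theorem conjIf_comp_eval_injective {b c : Bool} {i j : ι}
    (h : ∀ x : ι → ℂ, conjIf b (x i) = conjIf c (x j)) : b = c ∧ i = j := by
  classical
  constructor
  · exact conjIf_I_injective (h fun _ => Complex.I)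
  · by_contra hij
    have := h (Pi.single i 1)
    simp [Ne.symm hij] at this

/-- The only real algebra homomorphisms `(ι → ℂ) → ℂ` are the coordinates and their conjugates. -/
theorem exists_eq_conjIf_eval [Fintype ι] (χ : (ι → ℂ) →ₐ[ℝ] ℂ) :
    ∃ (j : ι) (b : Bool), ∀ x, χ x = conjIf b (x j) := by
  classical
  obtain ⟨j, hj⟩ : ∃ j, χ (Pi.single j 1) ≠ 0 := by
    by_contra! h
    have h1 : χ 1 = 0 := by
      rw [← Finset.univ_sum_single (1 : ι → ℂ), map_sum]
      exact Finset.sum_eq_zero fun i _ => h i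
    simp at h1
  have hj1 : χ (Pi.single j 1) = 1 := by
    refine mul_left_cancel₀ hj ?_
    rw [← map_mul, ← Pi.single_mul]
    simp
  let ψ : ℂ →ₐ[ℝ] ℂ :=
    { toFun := fun z => χ (Pi.single j z)
      map_one' := hj1
      map_mul' := fun z w => by rw [Pi.single_mul, map_mul]
      map_zero' := by simp
      map_add' := fun z w => by rw [Pi.single_add, map_add]
      commutes' := fun r => by
        have : (Pi.single j (algebraMap ℝ ℂ r) : ι → ℂ) = r • Pi.single j 1 := by
          rw [← Pi.single_smul, Algebra.algebraMap_eq_smul_one]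
        rw [this, map_smul, hj1, Algebra.algebraMap_eq_smul_one] }
  have hχ : ∀ x, χ x = ψ (x j) := fun x => by
    have : x * Pi.single j 1 = Pi.single j (x j) := by
      ext i
      by_cases h : i = j
      · subst h; simp
      · simp [h]
    change χ x = χ (Pi.single j (x j))
    rw [← this, map_mul, hj1, mul_one]
  rcases Complex.real_algHom_eq_id_or_conj ψ with h | h
  · exact ⟨j, false, fun x => by rw [hχ, h]; simp [conjIf]⟩
  · exact ⟨j, true, fun x => by rw [hχ, h]; simp [conjIf]⟩

/-- Involutions of `ι → ℂ` permute the coordinates and conjugate some of them. -/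
noncomputable def signedInvolutionEquiv (ι : Type*) [Fintype ι] :
    SignedInvolution ι ≃ {f : (ι → ℂ) → (ι → ℂ) // IsAlgInvolution f} :=
  Equiv.ofBijective (fun p => ⟨_, p.isAlgInvolution⟩) <| by
    constructor
    · rintro ⟨⟨σ, ε⟩, hp⟩ ⟨⟨τ, δ⟩, hq⟩ h
      have h' : ∀ i (x : ι → ℂ), conjIf (ε i) (x (σ i)) = conjIf (δ i) (x (τ i)) := fun i x =>
        congrFun (congrFun (congrArg Subtype.val h) x) i
      have hσ : σ = τ := funext fun i => (conjIf_comp_eval_injective (h' i)).2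
      have hε : ε = δ := funext fun i => (conjIf_comp_eval_injective (h' i)).1
      subst hσ hε
      rfl
    · rintro ⟨f, hf⟩
      choose σ ε h using fun i =>
        exists_eq_conjIf_eval ((Pi.evalAlgHom ℝ (fun _ : ι => ℂ) i).comp hf.toAlgHom)
      replace h : ∀ i x, f x i = conjIf (ε i) (x (σ i)) := h
      have hff : ∀ i (x : ι → ℂ), conjIf (ε i) (conjIf (ε (σ i)) (x (σ (σ i)))) = x i :=
        fun i x => by rw [← h, ← h, hf.involutive]
      have hε : ∀ i, ε (σ i) = ε i := fun i => by
        refine conjIf_I_injective ?_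
        have := congrArg (conjIf (ε i)) (hff i fun _ => Complex.I)
        simpa only [conjIf_conjIf_self] using this
      refine ⟨⟨(σ, ε), fun i => ?_, hε⟩, ?_⟩
      · refine (conjIf_comp_eval_injective (b := false) (c := false) fun x => ?_).2
        have := hff i x
        rw [hε, conjIf_conjIf_self] at this
        rw [this]
      · ext x i
        exact (h i x).symm

end Pi

/-- The involutions of the multicomplex numbers of order `n + 1` are the involutions of the signed
permutation group on `2 ^ n` letters. -/
theorem nonempty_involution_equiv (n : ℕ) :
    Nonempty ({f : MC (n + 1) → MC (n + 1) // IsMCInvolution f} ≃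
      SignedInvolution (Fin (2 ^ n))) := by
  obtain ⟨ι, _, hι, ⟨e⟩⟩ := exists_multicomplexEquiv n
  have e' := e.trans (AlgEquiv.piCongrLeft ℝ (fun _ => ℂ) (Fintype.equivFinOfCardEq hι))
  exact ⟨(Equiv.subtypeEquivRight fun f => isMCInvolution_iff f).trans <|
    (IsAlgInvolution.congr e').trans (signedInvolutionEquiv _).symm⟩

theorem numInvolutions_succ (n : ℕ) :
    numInvolutions (n + 1) = Nat.card (SignedInvolution (Fin (2 ^ n))) :=
  Nat.card_congr (nonempty_involution_equiv n).some

/-! ### Counting signed involutions -/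

/-- The sum in the closed formula, `m!` times the coefficient of `x ^ m` in `exp (2 x + x ^ 2)`. -/
noncomputable def signedInvolutionCount (m : ℕ) : ℝ :=
  (m ! : ℝ) * ∑ k ∈ Finset.range (m / 2 + 1),
    (2 : ℝ) ^ (m - 2 * k) / ((k ! : ℝ) * ((m - 2 * k)! : ℝ))

section Count

variable {ι : Type*} [Fintype ι]

/-- A function constant on the orbits of an involution `σ` is determined by its values at
the indices with `i ≤ σ i`, one in each orbit. -/
theorem card_invariant_of_involutive [LinearOrder ι] {σ : ι → ι} (hσ : Function.Involutive σ) :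
    Nat.card {ε : ι → Bool // ∀ i, ε (σ i) = ε i} =
      2 ^ Fintype.card {i // i ≤ σ i} := by
  let F : {ε : ι → Bool // ∀ i, ε (σ i) = ε i} ≃ ({i // i ≤ σ i} → Bool) :=
    { toFun := fun ε i => ε.1 i
      invFun := fun δ => ⟨fun i => if h : i ≤ σ i then δ ⟨i, h⟩ else
          δ ⟨σ i, by rw [hσ]; exact (not_le.1 h).le⟩, fun i => by
        rcases lt_trichotomy i (σ i) with h | h | h
        · simp only [dif_pos h.le, hσ i]
          rw [dif_neg (not_le.2 h)]
        · simp only [← h]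
        · have h2 : σ i ≤ σ (σ i) := by rw [hσ]; exact h.le
          simp only [dif_pos h2, dif_neg (not_le.2 h)]⟩
      left_inv := fun ε => by
        ext i
        by_cases h : i ≤ σ i
        · simp [h]
        · simp [h, ε.2 i]
      right_inv := fun δ => by
        ext i
        simp [i.2] }
  rw [Nat.card_congr F, Nat.card_eq_fintype_card]
  simp

theorem two_mul_card_le_involutive [LinearOrder ι] {σ : ι → ι} (hσ : Function.Involutive σ) :
    2 * Fintype.card {i // i ≤ σ i} = Fintype.card ι + Fintype.card {i // σ i = i} := by
  have h1 : Fintype.card {i // i ≤ σ i} = Fintype.card {i // σ i ≤ i} :=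
    Fintype.card_congr (hσ.toPerm.subtypeEquiv fun i => by simp [hσ i])
  rw [two_mul]
  nth_rw 2 [h1]
  simp only [Fintype.card_subtype]
  rw [← Finset.card_union_add_card_inter]
  congr 1
  · rw [← Finset.card_univ]
    congr 1
    ext i
    simpa using le_total i (σ i)
  · congr 1
    ext i
    simp only [Finset.mem_inter, Finset.mem_filter_univ]
    exact ⟨fun h => le_antisymm h.2 h.1, fun h => ⟨h.ge, h.le⟩⟩

open Equiv Equiv.Perm

/-- There are `m! / ((m - 2k)! 2^k k!)` involutive permutations with exactly `k` transpositions. -/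
theorem card_involutions_mul [DecidableEq ι] (k : ℕ) (hk : 2 * k ≤ Fintype.card ι) :
    (Finset.univ.filter fun σ : Perm ι => σ.cycleType = Multiset.replicate k 2).card *
      ((Fintype.card ι - 2 * k)! * 2 ^ k * k !) = (Fintype.card ι)! := by
  have h := Equiv.Perm.card_of_cycleType_mul_eq ι (Multiset.replicate k 2)
  rw [if_pos (by
    refine ⟨by simpa [mul_comm] using hk, fun a ha => ?_⟩
    rw [Multiset.eq_of_mem_replicate ha])] at h
  rw [← h]
  congr 2
  · simp [mul_comm]
  · rcases Nat.eq_zero_or_pos k with rfl | hk0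
    · simp
    · rw [Multiset.toFinset_replicate, if_neg hk0.ne']; simp

/-- A signed involution is an involution `σ` with `k` transpositions, for some `k`, together with
one of the `2 ^ (m - k)` sign functions constant on the `m - k` orbits of `σ`. -/
theorem card_signedInvolution [LinearOrder ι] :
    (Nat.card (SignedInvolution ι) : ℝ) = signedInvolutionCount (Fintype.card ι) := by
  rw [signedInvolutionCount]
  set m := Fintype.card ι
  let S := Finset.univ.filter fun σ : Perm ι => σ ^ 2 = 1
  have hinv : ∀ {σ : Perm ι}, σ ^ 2 = 1 ↔ Function.Involutive σ := fun {σ} => by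
    rw [sq, Equiv.ext_iff]; rfl
  -- Split off the permutation.
  let e : SignedInvolution ι ≃ Σ σ : S, {ε : ι → Bool // ∀ i, ε (σ.1 i) = ε i} :=
    { toFun := fun p => ⟨⟨p.2.1.toPerm, by simpa [S] using hinv.2 p.2.1⟩, ⟨p.1.2, p.2.2⟩⟩
      invFun := fun q => ⟨(q.1.1, q.2.1), hinv.1 (Finset.mem_filter.1 q.1.2).2, q.2.2⟩
      left_inv := fun p => rfl
      right_inv := fun q => by
        obtain ⟨⟨σ, hσ⟩, ε⟩ := q
        exact Sigma.subtype_ext (Subtype.ext (Equiv.ext fun _ => rfl)) rfl }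
  have hsum : ∀ σ : Perm ι, σ.cycleType.sum ≤ m := fun σ => by
    rw [σ.sum_cycleType]; exact Finset.card_le_univ _
  have hfib : ∀ σ ∈ S, Nat.card {ε : ι → Bool // ∀ i, ε (σ i) = ε i} =
      2 ^ (m - σ.cycleType.card) := fun σ hσ => by
    have hσ2 : σ ^ 2 = 1 := by simpa [S] using hσ
    have hi := hinv.1 hσ2
    rw [card_invariant_of_involutive hi]
    congr 1
    have h1 := two_mul_card_le_involutive hi
    have h2 := Equiv.Perm.cycleType_of_pow_prime_eq_one hσ2
    have h3 : Fintype.card {i // σ i = i} = m - σ.cycleType.sum := by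
      rw [← Equiv.Perm.card_fixedPoints]; rfl
    have h4 : σ.cycleType.sum = 2 * σ.cycleType.card := by
      conv_lhs => rw [h2]
      simp [mul_comm]
    have := hsum σ
    omega
  have hcard : Nat.card (SignedInvolution ι) = ∑ σ ∈ S, 2 ^ (m - σ.cycleType.card) := by
    rw [Nat.card_congr e, Nat.card_sigma, ← Finset.sum_coe_sort S]
    exact Finset.sum_congr rfl fun σ _ => hfib σ.1 σ.2
  have hmaps : ∀ σ ∈ S, σ.cycleType.card ∈ Finset.range (m / 2 + 1) := fun σ hσ => by
    have hσ2 : σ ^ 2 = 1 := by simpa [S] using hσ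
    have h2 := Equiv.Perm.cycleType_of_pow_prime_eq_one hσ2
    have h3 := hsum σ
    rw [h2] at h3
    simp only [Multiset.sum_replicate, smul_eq_mul] at h3
    rw [Finset.mem_range]
    omega
  rw [hcard, ← Finset.sum_fiberwise_of_maps_to hmaps]
  push_cast
  rw [Finset.mul_sum]
  refine Finset.sum_congr rfl fun k hk => ?_
  have hk' : 2 * k ≤ m := by rw [Finset.mem_range] at hk; omega
  have hset : S.filter (fun σ => σ.cycleType.card = k) =
      Finset.univ.filter fun σ : Perm ι => σ.cycleType = Multiset.replicate k 2 := by
    ext σ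
    simp only [S, Finset.mem_filter, Finset.mem_univ, true_and]
    constructor
    · rintro ⟨h1, rfl⟩
      exact Equiv.Perm.cycleType_of_pow_prime_eq_one h1
    · intro h
      refine ⟨Equiv.Perm.pow_prime_eq_one_iff.2 fun c hc => ?_, by rw [h]; simp⟩
      rw [h] at hc
      exact Multiset.eq_of_mem_replicate hc
  rw [hset, Finset.sum_congr rfl (g := fun _ => (2 : ℝ) ^ (m - k)) fun σ hσ => by
    rw [(Finset.mem_filter.1 hσ).2, Multiset.card_replicate]]
  rw [Finset.sum_const, nsmul_eq_mul]
  have h := congrArg (Nat.cast (R := ℝ)) (card_involutions_mul (ι := ι) k hk')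
  push_cast at h
  change _ = ((m ! : ℕ) : ℝ) at h
  rw [← h, show m - k = (m - 2 * k) + k by omega, pow_add]
  have := Nat.factorial_pos k
  have := Nat.factorial_pos (m - 2 * k)
  field_simp
  rfl

end Count

/-! ### The recurrence -/

theorem signedInvolutionCount_zero : signedInvolutionCount 0 = 1 := by
  simp [signedInvolutionCount]

theorem signedInvolutionCount_one : signedInvolutionCount 1 = 2 := by
  simp [signedInvolutionCount]

/-- The coefficient `c m` of `x ^ m` in `exp (2 x + x ^ 2)` satisfies
`(m + 2) c (m + 2) = 2 c (m + 1) + 2 c m`, by splitting `m + 2 = (m + 2 - 2 k) + 2 k` in the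
`k`-th summand. -/
theorem signedInvolutionCount_add_two (m : ℕ) :
    signedInvolutionCount (m + 2) =
      2 * signedInvolutionCount (m + 1) + 2 * (m + 1) * signedInvolutionCount m := by
  -- The summand, extended by zero so that all the sums have the same range.
  let t : ℕ → ℕ → ℝ := fun m k =>
    if 2 * k ≤ m then (2 : ℝ) ^ (m - 2 * k) / ((k ! : ℝ) * ((m - 2 * k)! : ℝ)) else 0
  have ht : ∀ m N, m / 2 + 1 ≤ N →
      signedInvolutionCount m = m ! * ∑ k ∈ Finset.range N, t m k := fun m N hN => by
    rw [signedInvolutionCount]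
    congr 1
    rw [← Finset.sum_subset (Finset.range_subset_range.2 hN)]
    · refine Finset.sum_congr rfl fun k hk => ?_
      rw [Finset.mem_range] at hk
      simp only [t]
      rw [if_pos (by omega)]
    · intro k _ hk
      rw [Finset.mem_range] at hk
      simp only [t]
      rw [if_neg (by omega)]
  have key1 : ∀ k, ((m : ℝ) + 2 - 2 * k) * t (m + 2) k = 2 * t (m + 1) k := fun k => by
    simp only [t]
    rcases lt_trichotomy (2 * k) (m + 2) with h | h | h
    · obtain ⟨d, hd⟩ : ∃ d, m + 1 = 2 * k + d := ⟨m + 1 - 2 * k, by omega⟩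
      have hr : (m : ℝ) + 2 - 2 * k = d + 1 := by
        have := congrArg (Nat.cast (R := ℝ)) hd
        push_cast at this
        linarith
      rw [if_pos (by omega), if_pos (by omega), hr, show m + 2 - 2 * k = d + 1 by omega,
        show m + 1 - 2 * k = d by omega, Nat.factorial_succ, pow_succ]
      push_cast
      field_simp
    · have hr : (m : ℝ) + 2 - 2 * k = 0 := by
        have := congrArg (Nat.cast (R := ℝ)) h
        push_cast at this
        linarith
      rw [if_neg (by omega : ¬ 2 * k ≤ m + 1), hr]; simp
    · rw [if_neg (by omega), if_neg (by omega)]; simp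
  have key2 : ∀ k, 2 * ((k + 1 : ℕ) : ℝ) * t (m + 2) (k + 1) = 2 * t m k := fun k => by
    simp only [t]
    by_cases h : 2 * k ≤ m
    · rw [if_pos (by omega), if_pos h, show m + 2 - 2 * (k + 1) = m - 2 * k by omega,
        Nat.factorial_succ]
      push_cast
      field_simp
    · rw [if_neg (by omega), if_neg h]; simp
  have hsum : ((m : ℝ) + 2) * ∑ k ∈ Finset.range (m + 3), t (m + 2) k =
      2 * ∑ k ∈ Finset.range (m + 3), t (m + 1) k + 2 * ∑ k ∈ Finset.range (m + 2), t m k := by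
    rw [Finset.mul_sum, Finset.mul_sum, Finset.mul_sum,
      ← Finset.sum_congr rfl fun k _ => key1 k, ← Finset.sum_congr rfl fun k _ => key2 k]
    have : ∑ k ∈ Finset.range (m + 2), 2 * ((k + 1 : ℕ) : ℝ) * t (m + 2) (k + 1) =
        ∑ k ∈ Finset.range (m + 3), 2 * (k : ℝ) * t (m + 2) k := by
      rw [Finset.sum_range_succ' _ (m + 2)]; simp
    rw [this, ← Finset.sum_add_distrib]
    exact Finset.sum_congr rfl fun k _ => by ring
  rw [ht (m + 2) (m + 3) (by omega), ht (m + 1) (m + 3) (by omega), ht m (m + 2) (by omega),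
    Nat.factorial_succ (m + 1), Nat.factorial_succ m]
  push_cast
  linear_combination ((m : ℝ) + 1) * (m !) * hsum

theorem eq_signedInvolutionCount {g : ℕ → ℝ} (h0 : g 1 = 2) (h1 : g 2 = 6)
    (hg : ∀ m : ℕ, 3 ≤ m → g m = 2 * g (m - 1) + (2 * (m : ℝ) - 2) * g (m - 2)) (m : ℕ) :
    g (m + 1) = signedInvolutionCount (m + 1) := by
  induction m using Nat.twoStepInduction with
  | zero => rw [h0, signedInvolutionCount_one]
  | one =>
    rw [h1, signedInvolutionCount_add_two, zero_add, signedInvolutionCount_one,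
      signedInvolutionCount_zero]
    norm_num
  | more m ih0 ih1 =>
    rw [hg (m + 2 + 1) (by omega), signedInvolutionCount_add_two (m + 1), ← ih0, ← ih1,
      show m + 2 + 1 - 1 = m + 1 + 1 by omega, show m + 2 + 1 - 2 = m + 1 by omega]
    push_cast
    ring

theorem numInvolutions_eq {n : ℕ} (hn : 1 ≤ n) :
    (numInvolutions n : ℝ) = signedInvolutionCount (2 ^ (n - 1)) := by
  obtain ⟨n, rfl⟩ := Nat.exists_eq_add_of_le' hn
  rw [numInvolutions_succ, card_signedInvolution, Fintype.card_fin]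
  rfl

/-! ### The count as a Gaussian moment -/

section Asymptotics

open MeasureTheory Real Topology

theorem integrable_pow_mul_exp_sub_sq (m : ℕ) :
    Integrable fun x : ℝ => x ^ m * exp (x - x ^ 2 / 4) := by
  have h := (integrable_rpow_mul_exp_neg_mul_sq (b := 1 / 8) (by norm_num) (s := m)
    (by have : (0 : ℝ) ≤ m := m.cast_nonneg
        linarith)).const_mul (exp 2)
  refine h.mono (by fun_prop) (ae_of_all _ fun x => ?_)
  simp only [rpow_natCast, norm_mul, norm_eq_abs, abs_exp]
  have : exp (x - x ^ 2 / 4) ≤ exp 2 * exp (-(1 / 8) * x ^ 2) := by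
    rw [← exp_add, exp_le_exp]
    nlinarith [sq_nonneg (x - 4)]
  calc |x ^ m| * exp (x - x ^ 2 / 4) ≤ |x ^ m| * (exp 2 * exp (-(1 / 8) * x ^ 2)) := by gcongr
    _ = _ := by ring

theorem integral_exp_quadratic {b c : ℝ} (hb : 0 < b) :
    ∫ x : ℝ, exp (c * x - b * x ^ 2) = exp (c ^ 2 / (4 * b)) * √(π / b) := by
  rw [← integral_gaussian, ← integral_sub_right_eq_self (fun x => exp (-b * x ^ 2)) (c / (2 * b)),
    ← integral_const_mul]
  congr 1
  ext x
  rw [← exp_add]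
  congr 1
  field_simp
  ring

theorem hasDerivAt_exp_sub_sq (x : ℝ) :
    HasDerivAt (fun x : ℝ => exp (x - x ^ 2 / 4)) (exp (x - x ^ 2 / 4) * (1 - x / 2)) x :=
  (((hasDerivAt_id' x).sub ((hasDerivAt_pow 2 x).div_const 4)).congr_deriv
    (by push_cast; ring)).exp

/-- Integration by parts for the moments of the weight `exp (x - x ^ 2 / 4)`. -/
theorem integral_pow_mul_exp_sub_sq_add_two (m : ℕ) :
    ∫ x : ℝ, x ^ (m + 2) * exp (x - x ^ 2 / 4) =
      2 * (∫ x : ℝ, x ^ (m + 1) * exp (x - x ^ 2 / 4)) +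
        2 * (m + 1) * ∫ x : ℝ, x ^ m * exp (x - x ^ 2 / 4) := by
  have hd : ∀ x : ℝ, HasDerivAt (fun x : ℝ => x ^ (m + 1) * exp (x - x ^ 2 / 4))
      ((m + 1) * (x ^ m * exp (x - x ^ 2 / 4)) + x ^ (m + 1) * exp (x - x ^ 2 / 4) -
        (1 / 2) * (x ^ (m + 2) * exp (x - x ^ 2 / 4))) x := fun x => by
    refine ((hasDerivAt_pow (m + 1) x).mul (hasDerivAt_exp_sub_sq x)).congr_deriv ?_
    rw [Nat.add_sub_cancel]
    push_cast
    ring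
  have i0 := (integrable_pow_mul_exp_sub_sq m).const_mul ((m : ℝ) + 1)
  have i1 := integrable_pow_mul_exp_sub_sq (m + 1)
  have i2 := (integrable_pow_mul_exp_sub_sq (m + 2)).const_mul (1 / 2)
  have h := integral_eq_zero_of_hasDerivAt_of_integrable hd ((i0.add i1).sub i2) i1
  have h' := (integral_sub (i0.add i1) i2).symm.trans h
  rw [integral_add' i0 i1, integral_const_mul, integral_const_mul] at h'
  linarith

/-- The count is the moment `E[(2 + √2 Z) ^ m]` of a normal variable, up to the normalization of
the weight: both sides satisfy the same recurrence. -/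
theorem integral_pow_mul_exp_sub_sq (m : ℕ) :
    ∫ x : ℝ, x ^ m * exp (x - x ^ 2 / 4) =
      exp 1 * √(4 * π) * signedInvolutionCount m := by
  have h0 : ∫ x : ℝ, exp (x - x ^ 2 / 4) = exp 1 * √(4 * π) := by
    have := integral_exp_quadratic (b := 1 / 4) (c := 1) (by norm_num)
    rw [show (1 : ℝ) ^ 2 / (4 * (1 / 4)) = 1 by norm_num,
      show π / (1 / 4) = 4 * π by ring] at this
    rw [← this]
    congr 1
    ext x
    ring_nf
  induction m using Nat.twoStepInduction with
  | zero => simpa [signedInvolutionCount_zero] using h0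
  | one =>
    have hd : ∀ x : ℝ, HasDerivAt (fun x : ℝ => exp (x - x ^ 2 / 4))
        (x ^ 0 * exp (x - x ^ 2 / 4) - (1 / 2) * (x ^ 1 * exp (x - x ^ 2 / 4))) x := fun x =>
      (hasDerivAt_exp_sub_sq x).congr_deriv (by ring)
    have i0 := integrable_pow_mul_exp_sub_sq 0
    have i1 := (integrable_pow_mul_exp_sub_sq 1).const_mul (1 / 2)
    have h := integral_eq_zero_of_hasDerivAt_of_integrable hd (i0.sub i1)
      (by simpa using i0)
    rw [integral_sub i0 i1, integral_const_mul] at h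
    simp only [pow_zero, one_mul, h0] at h
    rw [signedInvolutionCount_one]
    linarith
  | more m ih0 ih1 =>
    rw [integral_pow_mul_exp_sub_sq_add_two, ih0, ih1, signedInvolutionCount_add_two]
    ring

/-! ### Laplace's method -/

/-- The moment integrand folded onto `x > 0`, recentred at its peak `s` by `x = s + u`, where
`s = √(2 m)`, and divided by the normalization `s ^ m * exp (s - m / 2)`. -/
noncomputable def laplaceIntegrand (s u : ℝ) : ℝ :=
  if -s < u then exp (s ^ 2 / 2 * log (1 + u / s) - s * u / 2 - u ^ 2 / 4) *
    (exp u + exp (-u - 2 * s)) else 0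

theorem laplaceIntegrand_nonneg (s u : ℝ) : 0 ≤ laplaceIntegrand s u := by
  unfold laplaceIntegrand
  split_ifs <;> positivity

theorem laplaceIntegrand_le {s : ℝ} (hs : 0 < s) (u : ℝ) :
    laplaceIntegrand s u ≤ 2 * exp (u - u ^ 2 / 4) := by
  unfold laplaceIntegrand
  split_ifs with h
  · have hv : 0 < 1 + u / s := by
      have : 1 + u / s = (s + u) / s := by field_simp
      rw [this]
      exact div_pos (by linarith) hs
    have hlog : s ^ 2 / 2 * log (1 + u / s) ≤ s * u / 2 := by
      have := log_le_sub_one_of_pos hv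
      calc s ^ 2 / 2 * log (1 + u / s) ≤ s ^ 2 / 2 * (u / s) := by
            gcongr; linarith
        _ = s * u / 2 := by field_simp
    calc exp (s ^ 2 / 2 * log (1 + u / s) - s * u / 2 - u ^ 2 / 4) *
          (exp u + exp (-u - 2 * s)) ≤ exp (-u ^ 2 / 4) * (exp u + exp u) := by
          gcongr
          · linarith
          · linarith
      _ = 2 * exp (u - u ^ 2 / 4) := by
          rw [← two_mul, mul_left_comm, ← exp_add]; ring_nf
  · positivity

theorem tendsto_sq_mul_log_sub (u : ℝ) :
    Tendsto (fun s : ℝ => s ^ 2 / 2 * log (1 + u / s) - s * u / 2) atTop (𝓝 (-u ^ 2 / 4)) := by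
  rw [tendsto_iff_norm_sub_tendsto_zero]
  refine squeeze_zero' (g := fun s : ℝ => |u| ^ 3 / s) (Eventually.of_forall fun _ => norm_nonneg _)
    ?_ (tendsto_const_nhds.div_atTop tendsto_id)
  filter_upwards [eventually_gt_atTop 0, eventually_ge_atTop (2 * |u|)] with s hs hsu
  have habs : |-(u / s)| = |u| / s := by rw [abs_neg, abs_div, abs_of_pos hs]
  have hv : |u| / s ≤ 1 / 2 := by rw [div_le_iff₀ hs]; linarith
  have h := abs_log_sub_add_sum_range_le (x := -(u / s)) (by rw [habs]; linarith) 2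
  rw [habs] at h
  norm_num [Finset.sum_range_succ] at h
  have hle : (|u| / s) ^ 3 / (1 - |u| / s) ≤ 2 * (|u| / s) ^ 3 := by
    rw [div_le_iff₀ (by linarith)]
    have : 0 ≤ (|u| / s) ^ 3 := by positivity
    nlinarith
  rw [norm_eq_abs]
  have heq : s ^ 2 / 2 * log (1 + u / s) - s * u / 2 - -u ^ 2 / 4 =
      s ^ 2 / 2 * (-(u / s) + (u / s) ^ 2 / 2 + log (1 + u / s)) := by
    field_simp
    ring
  rw [heq, abs_mul, abs_of_pos (by positivity : 0 < s ^ 2 / 2)]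
  calc s ^ 2 / 2 * |-(u / s) + (u / s) ^ 2 / 2 + log (1 + u / s)|
      ≤ s ^ 2 / 2 * (2 * (|u| / s) ^ 3) := by gcongr; exact h.trans hle
    _ = |u| ^ 3 / s := by field_simp

theorem tendsto_laplaceIntegrand (u : ℝ) :
    Tendsto (fun s => laplaceIntegrand s u) atTop (𝓝 (exp (u - u ^ 2 / 2))) := by
  have h1 : Tendsto (fun s : ℝ => exp (-u - 2 * s)) atTop (𝓝 0) :=
    tendsto_exp_atBot.comp (tendsto_atBot_add_const_left _ _
      (tendsto_neg_atTop_atBot.comp (tendsto_id.const_mul_atTop two_pos)))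
  have h2 := ((continuous_exp.tendsto _).comp
    ((tendsto_sq_mul_log_sub u).sub_const (u ^ 2 / 4))).mul (h1.const_add (exp u))
  have h3 : exp (-u ^ 2 / 4 - u ^ 2 / 4) * (exp u + 0) = exp (u - u ^ 2 / 2) := by
    rw [add_zero, ← exp_add]; ring_nf
  rw [h3] at h2
  refine h2.congr' ?_
  filter_upwards [eventually_gt_atTop (-u)] with s hs
  simp [laplaceIntegrand, show -s < u by linarith]

theorem tendsto_integral_laplaceIntegrand :
    Tendsto (fun s => ∫ u, laplaceIntegrand s u) atTop (𝓝 (exp (1 / 2) * √(2 * π))) := by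
  have hlim : ∫ u : ℝ, exp (u - u ^ 2 / 2) = exp (1 / 2) * √(2 * π) := by
    have := integral_exp_quadratic (b := 1 / 2) (c := 1) (by norm_num)
    rw [show (1 : ℝ) ^ 2 / (4 * (1 / 2)) = 1 / 2 by norm_num,
      show π / (1 / 2) = 2 * π by ring] at this
    rw [← this]
    congr 1
    ext x
    ring_nf
  rw [← hlim]
  refine tendsto_integral_filter_of_dominated_convergence (fun u => 2 * exp (u - u ^ 2 / 4))
    (Eventually.of_forall fun s => ?_) ?_ ?_ (ae_of_all _ tendsto_laplaceIntegrand)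
  · exact (Measurable.ite measurableSet_Ioi (by fun_prop) measurable_const).aestronglyMeasurable
  · filter_upwards [eventually_gt_atTop 0] with s hs
    refine ae_of_all _ fun u => ?_
    rw [norm_of_nonneg (laplaceIntegrand_nonneg s u)]
    exact laplaceIntegrand_le hs u
  · simpa using (integrable_pow_mul_exp_sub_sq 0).const_mul 2

/-- For even `m` the substitution `x ↦ -x` on the negative half-line only turns `exp x` into
`exp (-x)`, so that the integrand folds onto `x > 0`, where it can be recentred at `s`. -/
theorem integral_pow_mul_exp_sub_sq_of_even {m : ℕ} (hm : Even m) {s : ℝ} (hs : 0 < s)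
    (hsm : s ^ 2 = 2 * m) :
    ∫ x : ℝ, x ^ m * exp (x - x ^ 2 / 4) =
      s ^ m * exp (s - m / 2) * ∫ u, laplaceIntegrand s u := by
  let h : ℝ → ℝ := fun x => x ^ m * exp (-x ^ 2 / 4) * (exp x + exp (-x))
  have hfold : ∫ x : ℝ, x ^ m * exp (x - x ^ 2 / 4) = ∫ x in Set.Ioi 0, h x := by
    have i0 := integrable_pow_mul_exp_sub_sq m
    have h1 : ∫ x, h |x| = (∫ x : ℝ, x ^ m * exp (x - x ^ 2 / 4)) +
        ∫ x : ℝ, (-x) ^ m * exp ((-x) - (-x) ^ 2 / 4) := by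
      rw [← integral_add i0 i0.comp_neg]
      congr 1
      ext x
      have : exp |x| + exp (-|x|) = exp x + exp (-x) := by
        rcases abs_cases x with ⟨e, _⟩ | ⟨e, _⟩ <;> rw [e]
        rw [neg_neg, add_comm]
      simp only [h]
      rw [this, hm.pow_abs, sq_abs, hm.neg_pow, mul_add, mul_assoc, mul_assoc, ← exp_add,
        ← exp_add]
      ring_nf
    rw [integral_comp_abs, integral_neg_eq_self (fun x : ℝ => x ^ m * exp (x - x ^ 2 / 4))] at h1
    linarith
  rw [hfold, ← integral_indicator measurableSet_Ioi, ← integral_add_right_eq_self _ s,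
    ← integral_const_mul]
  congr 1
  ext u
  by_cases hu : -s < u
  · have hpos : 0 < u + s := by linarith
    have hv : 0 < 1 + u / s := by
      have : 1 + u / s = (u + s) / s := by field_simp; ring
      rw [this]
      exact div_pos hpos hs
    rw [Set.indicator_of_mem (by exact hpos), laplaceIntegrand, if_pos hu]
    have hpow : (u + s) ^ m = s ^ m * exp (s ^ 2 / 2 * log (1 + u / s)) := by
      rw [show s ^ 2 / 2 = (m : ℝ) by rw [hsm]; ring, exp_nat_mul, exp_log hv, ← mul_pow]
      congr 1
      field_simp
      ring
    simp only [h]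
    rw [hpow, show (m : ℝ) = s ^ 2 / 2 by rw [hsm]; ring]
    simp only [mul_add, mul_assoc, ← exp_add]
    ring_nf
  · rw [Set.indicator_of_notMem (by simp only [Set.mem_Ioi]; linarith), laplaceIntegrand,
      if_neg hu, mul_zero]

/-- For `m = 2 ^ (n - 1)`, the peak is at `s = 2 ^ (n / 2)`. -/
theorem signedInvolutionCount_two_pow {n : ℕ} (hn : 2 ≤ n) :
    signedInvolutionCount (2 ^ (n - 1)) =
      ((2 : ℝ) ^ n / exp 1) ^ ((2 : ℝ) ^ ((n : ℝ) - 2)) *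
        (exp ((2 : ℝ) ^ ((n : ℝ) / 2)) / √(2 * exp 1)) *
      ((∫ u, laplaceIntegrand ((2 : ℝ) ^ ((n : ℝ) / 2)) u) / (exp (1 / 2) * √(2 * π))) := by
  set s : ℝ := (2 : ℝ) ^ ((n : ℝ) / 2) with hs
  obtain ⟨k, rfl⟩ : ∃ k, n = k + 2 := ⟨n - 2, by omega⟩
  have hs0 : 0 < s := by positivity
  have hs2 : s ^ 2 = (2 : ℝ) ^ (k + 2) := by
    rw [hs, ← rpow_natCast, ← rpow_mul two_pos.le, ← rpow_natCast]
    congr 1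
    push_cast
    ring
  have hm : k + 2 - 1 = k + 1 := rfl
  have hkey := integral_pow_mul_exp_sub_sq_of_even (m := 2 ^ (k + 1)) ⟨2 ^ k, by ring⟩ hs0
    (by rw [hs2]; push_cast; ring)
  rw [integral_pow_mul_exp_sub_sq] at hkey
  have hN : ((2 : ℝ) ^ (k + 2) / exp 1) ^ ((2 : ℝ) ^ (((k + 2 : ℕ) : ℝ) - 2)) * exp s =
      s ^ 2 ^ (k + 1) * exp (s - (2 ^ (k + 1) : ℕ) / 2) := by
    have he : (2 : ℝ) ^ (((k + 2 : ℕ) : ℝ) - 2) = ((2 ^ k : ℕ) : ℝ) := by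
      push_cast
      rw [add_sub_cancel_right, rpow_natCast]
    rw [he, rpow_natCast, div_pow, ← hs2, ← pow_mul, ← exp_nat_mul, exp_sub, ← pow_succ']
    push_cast
    rw [show (2 : ℝ) ^ (k + 1) / 2 = 2 ^ k * 1 by ring]
    ring
  have hsqrt : √(2 * exp 1) * (exp (1 / 2) * √(2 * π)) = exp 1 * √(4 * π) := by
    have h1 : √(exp 1) * √(exp 1) = exp 1 := mul_self_sqrt (exp_pos 1).le
    rw [exp_half, sqrt_mul two_pos.le, sqrt_mul two_pos.le, show 4 * π = 2 * (2 * π) by ring,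
      sqrt_mul two_pos.le, sqrt_mul two_pos.le]
    linear_combination √2 * √2 * √π * h1
  have hpos : 0 < exp 1 * √(4 * π) := by positivity
  rw [hm, ← mul_div_assoc (_ ^ _), hN, div_mul_div_comm, hsqrt, eq_div_iff hpos.ne', ← hkey]
  ring

theorem numInvolutions_isEquivalent :
    (fun n : ℕ => (numInvolutions n : ℝ)) ~[atTop]
      (fun n : ℕ => ((2 : ℝ) ^ n / exp 1) ^ ((2 : ℝ) ^ ((n : ℝ) - 2)) *
        (exp ((2 : ℝ) ^ ((n : ℝ) / 2)) / √(2 * exp 1))) := by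
  have hs : Tendsto (fun n : ℕ => (2 : ℝ) ^ ((n : ℝ) / 2)) atTop atTop :=
    (tendsto_rpow_atTop_of_base_gt_one 2 one_lt_two).comp
      (tendsto_natCast_atTop_atTop.atTop_div_const two_pos)
  have hpos : 0 < exp (1 / 2) * √(2 * π) := by positivity
  have hlim := (tendsto_integral_laplaceIntegrand.comp hs).div_const (exp (1 / 2) * √(2 * π))
  rw [div_self hpos.ne'] at hlim
  refine isEquivalent_of_tendsto_one (hlim.congr' ?_)
  filter_upwards [eventually_ge_atTop 2] with n hn
  have hT : ((2 : ℝ) ^ n / exp 1) ^ ((2 : ℝ) ^ ((n : ℝ) - 2)) *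
      (exp ((2 : ℝ) ^ ((n : ℝ) / 2)) / √(2 * exp 1)) ≠ 0 := by positivity
  simp only [Pi.div_apply, Function.comp_apply]
  rw [numInvolutions_eq (by omega), signedInvolutionCount_two_pow hn, mul_div_cancel_left₀ _ hT]

end Asymptotics

/-! ### The three claims -/

theorem floor_two_zpow_sub_two {n : ℕ} (hn : 1 ≤ n) :
    ⌊(2 : ℝ) ^ ((n : ℤ) - 2)⌋₊ = 2 ^ (n - 1) / 2 := by
  obtain ⟨n, rfl⟩ := Nat.exists_eq_add_of_le' hn
  rw [Nat.add_sub_cancel, ← Nat.floor_div_eq_div (K := ℝ)]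
  congr 1
  rw [show ((n + 1 : ℕ) : ℤ) - 2 = (n : ℤ) - 1 by push_cast; ring, zpow_sub₀ two_ne_zero]
  simp

theorem corollary5 :
    (∀ n : ℕ, 1 ≤ n →
      Finite {f : MC n → MC n // IsMCInvolution f} ∧
      (numInvolutions n : ℝ) =
        ((2 ^ (n - 1))! : ℝ) *
          ∑ k ∈ Finset.Icc 0 ⌊(2 : ℝ) ^ ((n : ℤ) - 2)⌋₊,
            (2 : ℝ) ^ (2 ^ (n - 1) - 2 * k) / ((k ! : ℝ) * ((2 ^ (n - 1) - 2 * k)! : ℝ))) ∧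
    (∀ g : ℕ → ℝ, g 1 = 2 → g 2 = 6 →
      (∀ m : ℕ, 3 ≤ m → g m = 2 * g (m - 1) + (2 * (m : ℝ) - 2) * g (m - 2)) →
      ∀ n : ℕ, 1 ≤ n → (numInvolutions n : ℝ) = g (2 ^ (n - 1))) ∧
    (fun n : ℕ => (numInvolutions n : ℝ)) ~[atTop]
      (fun n : ℕ => ((2 : ℝ) ^ n / Real.exp 1) ^ ((2 : ℝ) ^ ((n : ℝ) - 2)) *
        (Real.exp ((2 : ℝ) ^ ((n : ℝ) / 2)) / √(2 * Real.exp 1))) := by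
  refine ⟨fun n hn => ⟨?_, ?_⟩, fun g h1 h2 hg n hn => ?_, ?_⟩
  · obtain ⟨n, rfl⟩ := Nat.exists_eq_add_of_le' hn
    obtain ⟨e⟩ := nonempty_involution_equiv n
    exact Finite.of_equiv _ e.symm
  · rw [numInvolutions_eq hn, signedInvolutionCount, floor_two_zpow_sub_two hn,
      Nat.range_succ_eq_Icc_zero]
  · obtain ⟨m, hm⟩ : ∃ m, 2 ^ (n - 1) = m + 1 :=
      Nat.exists_eq_succ_of_ne_zero (pow_ne_zero _ two_ne_zero)
    rw [numInvolutions_eq hn, hm, eq_signedInvolutionCount h1 h2 hg]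
  · exact numInvolutions_isEquivalent
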